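/- For a permutation $\pi=\pi_1\cdots\pi_n\in\mathfrak S_n$, let $\operatorname{inv}(\pi)$ be the number of pairs $i<j$ with $\pi_i>\pi_j$, and let $\operatorname{udr}(\pi)$ be the number of up-down runs of $\pi$: an up-down run is either a maximal monotone (increasing or decreasing) consecutive subsequence of length at least two, or the first letter $\pi_1$ if it is by itself a maximal increasing consecutive subsequence. Let $$P_n^{(\operatorname{inv},\operatorname{udr})}(q,t)=\sum_{\pi\in\mathfrak S_n}q^{\operatorname{inv}(\pi)}t^{\operatorname{udr}(\pi)},\qquad [n]_q!=\prod_{k=1}^n(1+q+\cdots+q^{k-1}),$$ $$\exp_q(x)=\sum_{n\ge0}\frac{x^n}{[n]_q!},\qquad \operatorname{Exp}_q(x)=\sum_{n\ge0}q^{\binom n2}\frac{x^n}{[n]_q!}.$$ Let $K$ be a field of characteristic zero and let $q\in K$ satisfy $1+q+\cdots+q^{n-1}\neq0$ for all $n\ge1$ (for example, $q$ an indeterminate). The following identities of formal power series in $x$ hold. (a) For every $t\in K$ with $t^2\ne1$ and $t^2\neq-1$ (for example, $t$ an indeterminate), $$\frac{(1-t)(1+t\exp_q(x))}{1-t^2\exp_q(x)\operatorname{Exp}_q(x)}=1+\frac{1+t}{2}\sum_{n=1}^\infty\left(\frac{1+t^2}{1-t^2}\right)^nP_n^{(\operatorname{inv},\operatorname{udr})}\left(q,\frac{2t}{1+t^2}\right)\frac{x^n}{[n]_q!}.$$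 (b) Equivalently, $$\sum_{n=1}^\infty P_n^{(\operatorname{inv},\operatorname{udr})}(q,t)\frac{x^n}{[n]_q!}=\frac{2}{1+v}\left(\frac{(1-v)\left(1+v\exp_q\left(\frac{1-v^2}{1+v^2}x\right)\right)}{1-v^2\exp_q\left(\frac{1-v^2}{1+v^2}x\right)\operatorname{Exp}_q\left(\frac{1-v^2}{1+v^2}x\right)}-1\right),\qquad v=\frac{1-\sqrt{1-t^2}}{t}.$$ This holds for every $t\in K$ with $t\ne0$, $t^2\neq1$, and every choice in $K$ of a square root of $1-t^2$; and it holds over $K((t))$ for an indeterminate $t$, with $\sqrt{1-t^2}=\sum_{k\ge0}\binom{1/2}{k}(-t^2)^k$. -/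

import Mathlib

namespace UpDownRuns

/-- The word `π₁ ⋯ πₙ` is increasing on the positions from `i` to `j`. -/
def IncOn {n : ℕ} (π : Equiv.Perm (Fin n)) (i j : Fin n) : Prop :=
  ∀ a b : Fin n, i ≤ a → a < b → b ≤ j → π a < π b

/-- The word `π₁ ⋯ πₙ` is decreasing on the positions from `i` to `j`. -/
def DecOn {n : ℕ} (π : Equiv.Perm (Fin n)) (i j : Fin n) : Prop :=
  ∀ a b : Fin n, i ≤ a → a < b → b ≤ j → π b < π a

instance {n : ℕ} (π : Equiv.Perm (Fin n)) (i j : Fin n) : Decidable (IncOn π i j) := by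
  unfold IncOn; infer_instance

instance {n : ℕ} (π : Equiv.Perm (Fin n)) (i j : Fin n) : Decidable (DecOn π i j) := by
  unfold DecOn; infer_instance

/-- An increasing run: a maximal increasing consecutive subsequence, on the positions
from `i` to `j`. -/
def IsIncRun {n : ℕ} (π : Equiv.Perm (Fin n)) (i j : Fin n) : Prop :=
  i ≤ j ∧ IncOn π i j ∧
    ∀ i' j' : Fin n, i' ≤ i → j ≤ j' → IncOn π i' j' → i' = i ∧ j' = j

/-- A decreasing run: a maximal decreasing consecutive subsequence, on the positions
from `i` to `j`. -/
def IsDecRun {n : ℕ} (π : Equiv.Perm (Fin n)) (i j : Fin n) : Prop :=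
  i ≤ j ∧ DecOn π i j ∧
    ∀ i' j' : Fin n, i' ≤ i → j ≤ j' → DecOn π i' j' → i' = i ∧ j' = j

instance {n : ℕ} (π : Equiv.Perm (Fin n)) (i j : Fin n) : Decidable (IsIncRun π i j) := by
  unfold IsIncRun; infer_instance

instance {n : ℕ} (π : Equiv.Perm (Fin n)) (i j : Fin n) : Decidable (IsDecRun π i j) := by
  unfold IsDecRun; infer_instance

/-- A birun: an increasing run or a decreasing run, of length at least two. -/
def IsBirun {n : ℕ} (π : Equiv.Perm (Fin n)) (i j : Fin n) : Prop :=
  i < j ∧ (IsIncRun π i j ∨ IsDecRun π i j)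

instance {n : ℕ} (π : Equiv.Perm (Fin n)) (i j : Fin n) : Decidable (IsBirun π i j) := by
  unfold IsBirun; infer_instance

/-- An up-down run: a birun, or the first letter if it is an increasing run of length 1. -/
def IsUpDownRun {n : ℕ} (π : Equiv.Perm (Fin n)) (i j : Fin n) : Prop :=
  IsBirun π i j ∨ (i.val = 0 ∧ j = i ∧ IsIncRun π i i)

instance {n : ℕ} (π : Equiv.Perm (Fin n)) (i j : Fin n) : Decidable (IsUpDownRun π i j) := by
  unfold IsUpDownRun; infer_instance

/-- The number of up-down runs. -/
def udr {n : ℕ} (π : Equiv.Perm (Fin n)) : ℕ :=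
  (Finset.univ.filter fun p : Fin n × Fin n => IsUpDownRun π p.1 p.2).card

/-- The number of inversions. -/
def inv {n : ℕ} (π : Equiv.Perm (Fin n)) : ℕ :=
  (Finset.univ.filter fun p : Fin n × Fin n => p.1 < p.2 ∧ π p.2 < π p.1).card

/-- `P_n^{(inv,udr)}(q,t)`, the sum of `q ^ inv π * t ^ udr π` over the `n`-permutations `π`. -/
def invUdrPoly {R : Type*} [CommSemiring R] (n : ℕ) (q t : R) : R :=
  ∑ π : Equiv.Perm (Fin n), q ^ inv π * t ^ udr π

/-- `[n]_q = 1 + q + ⋯ + q^(n-1)`. -/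
def qNumber {R : Type*} [CommSemiring R] (q : R) (n : ℕ) : R :=
  ∑ i ∈ Finset.range n, q ^ i

/-- `[n]_q! = [1]_q [2]_q ⋯ [n]_q`. -/
def qFactorial {R : Type*} [CommSemiring R] (q : R) (n : ℕ) : R :=
  ∏ k ∈ Finset.range n, qNumber q (k + 1)

/-- `exp_q(x) = ∑ x^n / [n]_q!`, a formal power series in `x`. -/
noncomputable def smallExp {K : Type*} [Field K] (q : K) : PowerSeries K :=
  PowerSeries.mk fun n => 1 / qFactorial q n

/-- `Exp_q(x) = ∑ q^(n choose 2) x^n / [n]_q!`, a formal power series in `x`. -/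
noncomputable def bigExp {K : Type*} [Field K] (q : K) : PowerSeries K :=
  PowerSeries.mk fun n => q ^ (n.choose 2) / qFactorial q n

/-- The `q`-exponential generating function `∑_{n ≥ 1} a_n x^n / [n]_q!`, without the term
`n = 0`. -/
noncomputable def qGenFun {K : Type*} [Field K] (q : K) (a : ℕ → K) : PowerSeries K :=
  PowerSeries.mk fun n => if n = 0 then 0 else a n / qFactorial q n

/-- The formal power series `√(1 - t²) = ∑ (1/2 choose k) (-t²)^k` in `t`. -/
noncomputable def sqrtSeries (K : Type*) [Field K] [CharZero K] : PowerSeries K :=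
  (PowerSeries.binomialSeries K (1 / 2 : ℚ)).subst (-(PowerSeries.X ^ 2) : PowerSeries K)

/-- The indeterminate `t` of the field of formal Laurent series `K((t))`. -/
noncomputable def formalT (K : Type*) [Field K] : LaurentSeries K :=
  ((PowerSeries.X : PowerSeries K) : LaurentSeries K)

/-- `v = (1 - √(1 - t²)) / t` in the field of formal Laurent series `K((t))`. -/
noncomputable def formalV (K : Type*) [Field K] [CharZero K] : LaurentSeries K :=
  (1 - (sqrtSeries K : LaurentSeries K)) / formalT K

/-- The right-hand side of the inverted form, as a formal power series in `x`:
`2/(1+v) * ((1-v)(1 + v exp_q(cx)) / (1 - v² exp_q(cx) Exp_q(cx)) - 1)` with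
`c = (1-v²)/(1+v²)`. Here `rescale c` replaces `x` by `c x`, and `⁻¹` is the inverse of a power
series with nonzero constant term. -/
noncomputable def invertedForm {K : Type*} [Field K] (q v : K) : PowerSeries K :=
  PowerSeries.C (2 / (1 + v)) *
    (PowerSeries.C (1 - v) *
        (1 + PowerSeries.C v * PowerSeries.rescale ((1 - v ^ 2) / (1 + v ^ 2)) (smallExp q)) *
        (1 - PowerSeries.C (v ^ 2) *
            PowerSeries.rescale ((1 - v ^ 2) / (1 + v ^ 2)) (smallExp q) *
            PowerSeries.rescale ((1 - v ^ 2) / (1 + v ^ 2)) (bigExp q))⁻¹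
      - 1)

end UpDownRuns

/-! ### q-factorials, Gaussian binomials and block recursions -/

namespace UpDownRuns

/-! Cut the word of a permutation into `k` consecutive blocks, possibly empty, alternately
increasing and decreasing, starting with an increasing one. With inversions marked by `q`, an
increasing block contributes `exp_q` and a decreasing one `Exp_q`; marking each block by `t` and
summing over `k` gives `(1 + t exp_q) / (1 - t² exp_q Exp_q)`.

For a fixed permutation, sum over all its cuttings. Following the parity of the block that holds the
current letter, a step that keeps the direction multiplies the weight by `c = (1+t²)/(1-t²)`, and
one that changes it by `cT`, with `T = 2t/(1+t²)`. As the word starts from an up block, the first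
letter counts as reached by an ascent, so the exponent of `T` is exactly `udr`. This is the left
side of (a) up to the factor `1 - t`.

The infinite sum over `k` is only motivation. `runWeight` computes the weighted sums letter by
letter. Its combinations `oddBlocks` and `evenBlocks`, normalized by `1 - t²`, have generating
functions `Y` and `Z` satisfying `Y = t exp_q Z` and `Z - (1 - t²) = t Exp_q Y` (`oddBlocks_eq_sum`,
`evenBlocks_eq_sum`). Only the equations defining `c` and `T` are used, so `t` may be any admissible
field element. Eliminating `Y` and `Z` gives (a); rescaling `x` and solving `2v/(1+v²) = t` gives
(b). -/

theorem qNumber_add {R : Type*} [CommSemiring R] (q : R) (m n : ℕ) :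
    qNumber q (m + n) = qNumber q m + q ^ m * qNumber q n := by
  simp [qNumber, Finset.sum_range_add, Finset.mul_sum, pow_add]

theorem qFactorial_zero {R : Type*} [CommSemiring R] (q : R) : qFactorial q 0 = 1 := by
  simp [qFactorial]

theorem qFactorial_succ {R : Type*} [CommSemiring R] (q : R) (n : ℕ) :
    qFactorial q (n + 1) = qFactorial q n * qNumber q (n + 1) := by
  simp [qFactorial, Finset.prod_range_succ]

theorem qFactorial_ne_zero {K : Type*} [Field K] {q : K}
    (hq : ∀ n : ℕ, 1 ≤ n → qNumber q n ≠ 0) (n : ℕ) : qFactorial q n ≠ 0 :=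
  Finset.prod_ne_zero_iff.2 fun k _ => hq (k + 1) (by omega)

/-- The Gaussian binomial coefficient, as a quotient of `q`-factorials. -/
noncomputable def qChoose {K : Type*} [Field K] (q : K) (n k : ℕ) : K :=
  if k ≤ n then qFactorial q n / (qFactorial q k * qFactorial q (n - k)) else 0

section qChoose

variable {K : Type*} [Field K] {q : K}

theorem qChoose_of_lt {n k : ℕ} (h : n < k) : qChoose q n k = 0 := by
  simp [qChoose, not_le.2 h]

theorem qChoose_add (m k : ℕ) :
    qChoose q (m + k) m = qFactorial q (m + k) / (qFactorial q m * qFactorial q k) := by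
  simp [qChoose]

theorem qChoose_zero (hq : ∀ n : ℕ, 1 ≤ n → qNumber q n ≠ 0) (n : ℕ) : qChoose q n 0 = 1 := by
  simp [qChoose, qFactorial_zero, qFactorial_ne_zero hq n]

theorem qChoose_self (hq : ∀ n : ℕ, 1 ≤ n → qNumber q n ≠ 0) (n : ℕ) : qChoose q n n = 1 := by
  simp [qChoose, qFactorial_zero, qFactorial_ne_zero hq n]

theorem qChoose_succ_succ (hq : ∀ n : ℕ, 1 ≤ n → qNumber q n ≠ 0) (n k : ℕ) :
    qChoose q (n + 1) (k + 1) = q ^ (k + 1) * qChoose q n (k + 1) + qChoose q n k := by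
  rcases lt_trichotomy n k with h | rfl | h
  · simp [qChoose_of_lt, h, Nat.lt_succ_of_lt h]
  · simp [qChoose_self hq, qChoose_of_lt]
  · obtain ⟨d, rfl⟩ := Nat.exists_eq_add_of_lt h
    have h1 : k + d + 1 + 1 = (k + 1) + (d + 1) := by ring
    have h2 : k + d + 1 = (k + 1) + d := by ring
    have h3 : k + d + 1 = k + (d + 1) := by ring
    rw [h1, qChoose_add, h2, qChoose_add, ← h2, h3, qChoose_add, ← h3, ← h1,
      qFactorial_succ q (k + d + 1), qFactorial_succ q d, qFactorial_succ q k, h1, qNumber_add]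
    have := qFactorial_ne_zero hq k
    have := qFactorial_ne_zero hq d
    have := hq (k + 1) (by omega)
    have := hq (d + 1) (by omega)
    field_simp
    ring

/-- The other q-Pascal rule has the coefficient `q^(n-k)`; multiplying through by `q^k` avoids the
subtraction, and `q = 0` remains allowed. -/
theorem qChoose_succ_succ' (hq : ∀ n : ℕ, 1 ≤ n → qNumber q n ≠ 0) (n k : ℕ) :
    q ^ k * qChoose q (n + 1) (k + 1)
      = q ^ k * qChoose q n (k + 1) + q ^ n * qChoose q n k := by
  rcases lt_trichotomy n k with h | rfl | h
  · simp [qChoose_of_lt, h, Nat.lt_succ_of_lt h]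
  · simp [qChoose_self hq, qChoose_of_lt]
  · obtain ⟨d, rfl⟩ := Nat.exists_eq_add_of_lt h
    have h1 : k + d + 1 + 1 = (d + 1) + (k + 1) := by ring
    have h1' : k + d + 1 + 1 = (k + 1) + (d + 1) := by ring
    have h2 : k + d + 1 = (k + 1) + d := by ring
    have h3 : k + d + 1 = k + (d + 1) := by ring
    rw [h1', qChoose_add, h2, qChoose_add, ← h2, h3, qChoose_add, ← h3, ← h1',
      qFactorial_succ q (k + d + 1), qFactorial_succ q d, qFactorial_succ q k, h1, qNumber_add]
    have := qFactorial_ne_zero hq k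
    have := qFactorial_ne_zero hq d
    have := hq (k + 1) (by omega)
    have := hq (d + 1) (by omega)
    field_simp
    ring

theorem sum_pow_mul_qChoose (hq : ∀ n : ℕ, 1 ≤ n → qNumber q n ≠ 0) (n m j : ℕ)
    (hj : j ≤ n + 1) :
    ∑ i ∈ Finset.range j, q ^ ((m + 1) * (n - i)) * qChoose q i m
      = q ^ ((m + 1) * (n + 1 - j)) * qChoose q j (m + 1) := by
  induction j with
  | zero => simp [qChoose_of_lt]
  | succ j ih =>
    rw [Finset.sum_range_succ, ih (by omega), qChoose_succ_succ hq]
    have h1 : n + 1 - j = (n - j) + 1 := by omega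
    have h2 : n + 1 - (j + 1) = n - j := by omega
    rw [h1, h2, mul_add, mul_one, pow_add]
    ring

theorem sum_pow_mul_qChoose' (hq : ∀ n : ℕ, 1 ≤ n → qNumber q n ≠ 0) (m k : ℕ) :
    ∑ r ∈ Finset.range k, q ^ r * (q ^ (m.choose 2) * qChoose q r m)
      = q ^ ((m + 1).choose 2) * qChoose q k (m + 1) := by
  induction k with
  | zero => simp [qChoose_of_lt]
  | succ k ih =>
    rw [Finset.sum_range_succ, ih, Nat.choose_succ_succ' m 1, Nat.choose_one_right]
    linear_combination (-q ^ (m.choose 2)) * qChoose_succ_succ' hq k m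

/-- A triangular array whose rows grow by appending an ascent has row sums that are
`q`-binomial convolutions. -/
theorem partial_sum_of_ascent_rec (hq : ∀ n : ℕ, 1 ≤ n → qNumber q n ≠ 0)
    (δ : ℕ → ℕ → K) (F : ℕ → K) (h0 : δ 0 0 = F 0)
    (hs : ∀ n j, j ≤ n + 1 →
      δ (n + 1) j = q ^ (n + 1 - j) * (F (n + 1) + ∑ i ∈ Finset.range j, δ n i))
    (n j : ℕ) (hj : j ≤ n + 1) :
    ∑ i ∈ Finset.range j, δ n i
      = ∑ m ∈ Finset.range (n + 1),
          F (n - m) * (q ^ ((m + 1) * (n + 1 - j)) * qChoose q j (m + 1)) := by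
  induction n generalizing j with
  | zero =>
    interval_cases j
    · simp [qChoose_of_lt]
    · simp [h0, qChoose_self hq]
  | succ n ih =>
    simp_rw [← sum_pow_mul_qChoose hq (n + 1) _ j hj, Finset.mul_sum]
    rw [Finset.sum_comm]
    refine Finset.sum_congr rfl fun i hi => ?_
    have hi' := Finset.mem_range.1 hi
    -- The term split off, with index `0`, is the block consisting of the new letter alone. In
    -- general `m + 1` is the length of the last increasing block: its letters are chosen among the
    -- `j` smallest values, and each is inverted with all `n + 1 - j` larger values, which lie in
    -- the prefix.
    rw [hs n i (by omega), ih i (by omega), Finset.sum_range_succ' _ (n + 1), mul_add,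
      Finset.mul_sum, add_comm]
    congr 1
    · refine Finset.sum_congr rfl fun m _ => ?_
      rw [show n + 1 - (m + 1) = n - m by omega]
      ring
    · simp [qChoose_zero hq]
      ring

/-- A triangular array whose rows grow by appending a descent has row sums that are
`q`-binomial convolutions. -/
theorem partial_sum_of_descent_rec (hq : ∀ n : ℕ, 1 ≤ n → qNumber q n ≠ 0)
    (δ : ℕ → ℕ → K) (F : ℕ → K) (h0 : δ 0 0 = F 0)
    (hs : ∀ n j, j ≤ n + 1 →
      δ (n + 1) j = q ^ (n + 1 - j) * (F (n + 1) + ∑ i ∈ Finset.Ico j (n + 1), δ n i))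
    (n j : ℕ) (hj : j ≤ n + 1) :
    ∑ i ∈ Finset.Ico j (n + 1), δ n i
      = ∑ m ∈ Finset.range (n + 1),
          F (n - m) * (q ^ ((m + 1).choose 2) * qChoose q (n + 1 - j) (m + 1)) := by
  induction n generalizing j with
  | zero =>
    interval_cases j
    · simp [h0, qChoose_self hq]
    · simp [qChoose_of_lt]
  | succ n ih =>
    simp_rw [← sum_pow_mul_qChoose' hq _ (n + 1 + 1 - j), Finset.mul_sum]
    -- Reversing the order makes the summation index the number of values above the last letter. A
    -- decreasing block of `m + 1` letters, all at least `j`, has `(m+1).choose 2` internal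
    -- inversions.
    rw [Finset.sum_comm, Finset.sum_Ico_eq_sum_range, ← Finset.sum_range_reflect]
    refine Finset.sum_congr rfl fun i hi => ?_
    have hi' := Finset.mem_range.1 hi
    obtain ⟨l, hl⟩ : ∃ l, l = j + (n + 1 + 1 - j - 1 - i) := ⟨_, rfl⟩
    rw [← hl, hs n l (by omega), ih l (by omega), Finset.sum_range_succ' _ (n + 1), mul_add, Finset.mul_sum,
      add_comm]
    have hli : n + 1 - l = i := by omega
    rw [hli]
    congr 1
    · refine Finset.sum_congr rfl fun m _ => ?_
      rw [show n + 1 - (m + 1) = n - m by omega]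
      ring
    · simp [qChoose_zero hq]
      ring

end qChoose
-- Up-down runs in terms of ascents
section Runs

variable {n : ℕ}

/-- The letter in position `k` (counted from `0`) of the word of `π`, with value `0` past the end. -/
def letter (π : Equiv.Perm (Fin n)) (k : ℕ) : ℕ :=
  if h : k < n then (π ⟨k, h⟩ : ℕ) else 0

/-- The step into position `k` goes up; the first letter counts as the end of an ascent. -/
def IsAscent (π : Equiv.Perm (Fin n)) (k : ℕ) : Prop :=
  k = 0 ∨ letter π (k - 1) < letter π k

instance (π : Equiv.Perm (Fin n)) (k : ℕ) : Decidable (IsAscent π k) := by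
  unfold IsAscent; infer_instance

theorem letter_val (π : Equiv.Perm (Fin n)) (i : Fin n) : letter π i = π i := by
  simp [letter]

theorem letter_injOn (π : Equiv.Perm (Fin n)) {k l : ℕ} (hk : k < n) (hl : l < n)
    (h : letter π k = letter π l) : k = l := by
  simpa [letter, hk, hl, Fin.val_inj] using h

theorem isAscent_zero (π : Equiv.Perm (Fin n)) : IsAscent π 0 := Or.inl rfl

theorem incOn_iff (π : Equiv.Perm (Fin n)) (i j : Fin n) :
    IncOn π i j ↔ ∀ k : ℕ, i < k → k ≤ j → IsAscent π k := by
  constructor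
  · intro h k hik hkj
    have hk : k < n := lt_of_le_of_lt hkj j.2
    have := h ⟨k - 1, by omega⟩ ⟨k, hk⟩ (Fin.le_def.2 (by simp; omega))
      (Fin.lt_def.2 (by simp; omega)) (Fin.le_def.2 hkj)
    right
    simpa [letter, hk, show k - 1 < n by omega] using this
  · intro h a b hia hab hbj
    rw [Fin.lt_def, ← letter_val, ← letter_val]
    have key : ∀ l : ℕ, (a : ℕ) < l → l ≤ j → letter π a < letter π l := by
      intro l hl
      induction l, hl using Nat.le_induction with
      | base =>
        intro hj
        simpa using (h (a + 1) (by have := Fin.le_def.1 hia; omega) hj).resolve_left (by omega)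
      | succ l hl ih =>
        intro hj
        have h1 := (h (l + 1) (by have := Fin.le_def.1 hia; omega) hj).resolve_left (by omega)
        exact (ih (by omega)).trans (by simpa using h1)
    exact key b hab hbj

theorem decOn_iff (π : Equiv.Perm (Fin n)) (i j : Fin n) :
    DecOn π i j ↔ ∀ k : ℕ, i < k → k ≤ j → ¬ IsAscent π k := by
  constructor
  · intro h k hik hkj
    have hk : k < n := lt_of_le_of_lt hkj j.2
    have := h ⟨k - 1, by omega⟩ ⟨k, hk⟩ (Fin.le_def.2 (by simp; omega))
      (Fin.lt_def.2 (by simp; omega)) (Fin.le_def.2 hkj)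
    rintro (h0 | h1)
    · omega
    · simp only [letter, hk, show k - 1 < n by omega, dite_true] at h1
      exact absurd h1 (not_lt.2 this.le)
  · intro h a b hia hab hbj
    rw [Fin.lt_def, ← letter_val, ← letter_val]
    have hstep : ∀ l : ℕ, (i : ℕ) < l + 1 → l + 1 ≤ j → letter π (l + 1) < letter π l := by
      intro l h1 h2
      have h3 := h (l + 1) h1 h2
      simp only [IsAscent, not_or, Nat.add_sub_cancel, not_lt] at h3
      -- A non-ascent only gives a weak inequality; injectivity of the permutation makes it strict.
      refine lt_of_le_of_ne h3.2 fun h4 => ?_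
      have := letter_injOn π (k := l + 1) (l := l) (by omega) (by omega) h4
      omega
    have key : ∀ l : ℕ, (a : ℕ) < l → l ≤ j → letter π l < letter π a := by
      intro l hl
      induction l, hl using Nat.le_induction with
      | base => exact hstep a (by have := Fin.le_def.1 hia; omega)
      | succ l hl ih =>
        intro hj
        exact (hstep l (by have := Fin.le_def.1 hia; omega) hj).trans (ih (by omega))
    exact key b hab hbj

/-- An interval that can be enlarged at all can be enlarged by one step at one end, so maximality is
a condition on the two neighbouring steps. -/
theorem maximal_interval_iff (P : ℕ → Prop) (i j : Fin n) :
    (i ≤ j ∧ (∀ k : ℕ, i < k → k ≤ j → P k) ∧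
      ∀ i' j' : Fin n, i' ≤ i → j ≤ j' → (∀ k : ℕ, i' < k → k ≤ j' → P k) → i' = i ∧ j' = j) ↔
    (i ≤ j ∧ (∀ k : ℕ, i < k → k ≤ j → P k) ∧
      ((i : ℕ) = 0 ∨ ¬ P i) ∧ ((j : ℕ) + 1 = n ∨ ¬ P (j + 1))) := by
  refine and_congr_right fun hij => and_congr_right fun hP => ?_
  constructor
  · intro h
    constructor
    · by_contra! hc
      have := (h ⟨i - 1, by omega⟩ j (Fin.le_def.2 (by simp)) le_rfl (fun k h1 h2 => by
        simp only at h1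
        rcases (show k = i ∨ (i : ℕ) < k by omega) with rfl | h3
        · exact hc.2
        · exact hP k h3 h2)).1
      have := congrArg Fin.val this
      simp only at this
      omega
    · by_contra! hc
      have hj := j.2
      have := (h i ⟨j + 1, by omega⟩ le_rfl (Fin.le_def.2 (by simp)) (fun k h1 h2 => by
        simp only at h2
        rcases (show k = j + 1 ∨ k ≤ j by omega) with rfl | h3
        · exact hc.2
        · exact hP k h1 h3)).2
      have := congrArg Fin.val this
      simp at this
  · rintro ⟨h1, h2⟩ i' j' hi hj hP'
    rw [Fin.le_def] at hi hj hij
    have := j'.2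
    constructor
    · by_contra hne
      have hne' : (i' : ℕ) ≠ i := fun h => hne (Fin.ext h)
      exact (h1.resolve_left (by omega)) (hP' i (by omega) (by omega))
    · by_contra hne
      have hne' : (j' : ℕ) ≠ j := fun h => hne (Fin.ext h)
      exact (h2.resolve_left (by omega)) (hP' (j + 1) (by omega) (by omega))

theorem isIncRun_iff (π : Equiv.Perm (Fin n)) (i j : Fin n) :
    IsIncRun π i j ↔ i ≤ j ∧ (∀ k : ℕ, i < k → k ≤ j → IsAscent π k) ∧
      ((i : ℕ) = 0 ∨ ¬ IsAscent π i) ∧ ((j : ℕ) + 1 = n ∨ ¬ IsAscent π (j + 1)) := by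
  simp only [IsIncRun, incOn_iff, maximal_interval_iff]

theorem isDecRun_iff (π : Equiv.Perm (Fin n)) (i j : Fin n) :
    IsDecRun π i j ↔ i ≤ j ∧ (∀ k : ℕ, i < k → k ≤ j → ¬ IsAscent π k) ∧
      ((i : ℕ) = 0 ∨ IsAscent π i) ∧ ((j : ℕ) + 1 = n ∨ IsAscent π (j + 1)) := by
  simpa only [IsDecRun, decOn_iff, not_not] using
    maximal_interval_iff (fun k => ¬ IsAscent π k) i j

/-- Increasing and decreasing runs merge into maximal stretches of constant direction. With the
first letter counted as an ascent, the exceptional run of length one is the stretch from `0` to `0`.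
-/
theorem isUpDownRun_iff (π : Equiv.Perm (Fin n)) (i j : Fin n) :
    IsUpDownRun π i j ↔
      ((∀ k : ℕ, i < k → k ≤ j → (IsAscent π k ↔ IsAscent π j)) ∧
      ((j : ℕ) + 1 = n ∨ ¬ (IsAscent π j ↔ IsAscent π (j + 1)))) ∧
      ((i : ℕ) < j ∧ ((i : ℕ) = 0 ∨ ¬ (IsAscent π i ↔ IsAscent π j)) ∨
        (i : ℕ) = 0 ∧ (j : ℕ) = 0) := by
  have h0 := isAscent_zero π
  rw [IsUpDownRun, IsBirun, isIncRun_iff, isDecRun_iff, isIncRun_iff]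
  simp only [Fin.lt_def, Fin.le_def, Fin.ext_iff]
  by_cases hj : IsAscent π j
  · simp only [hj, iff_true, true_iff]
    constructor
    · rintro (⟨h, ⟨h1, h2, h3, h4⟩ | ⟨h1, h2, h3, h4⟩⟩ | ⟨h1, h2, h3, h4, h5, h6⟩)
      · exact ⟨⟨h2, h4⟩, Or.inl ⟨h, h3⟩⟩
      · exact absurd hj (h2 j h le_rfl)
      · refine ⟨⟨fun k h7 h8 => by omega, ?_⟩, Or.inr ⟨h1, by omega⟩⟩
        rwa [h2]
    · rintro ⟨⟨h1, h2⟩, ⟨h3, h4⟩ | ⟨h3, h4⟩⟩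
      · exact Or.inl ⟨h3, Or.inl ⟨h3.le, h1, h4, h2⟩⟩
      · refine Or.inr ⟨h3, by omega, le_rfl, fun k h5 h6 => by omega, Or.inl h3, ?_⟩
        rwa [h3, ← h4]
  · have hj0 : (j : ℕ) ≠ 0 := fun h => hj (by rw [h]; exact h0)
    simp only [hj, iff_false, false_iff, not_not]
    constructor
    · rintro (⟨h, ⟨h1, h2, h3, h4⟩ | ⟨h1, h2, h3, h4⟩⟩ | ⟨h1, h2, h3, h4, h5, h6⟩)
      · exact absurd (h2 j h le_rfl) hj
      · exact ⟨⟨h2, h4⟩, Or.inl ⟨h, h3⟩⟩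
      · omega
    · rintro ⟨⟨h1, h2⟩, ⟨h3, h4⟩ | ⟨h3, h4⟩⟩
      · exact Or.inl ⟨h3, Or.inr ⟨h3.le, h1, h4, h2⟩⟩
      · omega

/-- Up-down runs are counted by their right ends. -/
theorem udr_eq_card_ends (π : Equiv.Perm (Fin n)) :
    udr π = ((Finset.range n).filter fun k =>
      k + 1 = n ∨ ¬ (IsAscent π k ↔ IsAscent π (k + 1))).card := by
  unfold udr
  refine Finset.card_bij (fun p _ => (p.2 : ℕ)) ?_ ?_ ?_
  · rintro ⟨i, j⟩ h
    simp only [Finset.mem_filter, Finset.mem_univ, true_and, isUpDownRun_iff] at h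
    simpa using h.1.2
  · rintro ⟨i, j⟩ h ⟨i', j'⟩ h' hjj
    simp only [Finset.mem_filter, Finset.mem_univ, true_and, isUpDownRun_iff] at h h'
    obtain rfl : j = j' := Fin.ext hjj
    suffices (i : ℕ) = i' by rw [Fin.ext this]
    obtain ⟨⟨h1, -⟩, h2⟩ := h
    obtain ⟨⟨h1', -⟩, h2'⟩ := h'
    rcases lt_trichotomy (i : ℕ) i' with hl | hl | hl
    · exfalso
      have := h1 i' hl (by omega)
      rcases h2' with ⟨h3, h4 | h4⟩ | h3
      · omega
      · exact h4 this
      · omega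
    · exact hl
    · exfalso
      have := h1' i hl (by omega)
      rcases h2 with ⟨h3, h4 | h4⟩ | h3
      · omega
      · exact h4 this
      · omega
  · intro k hk
    simp only [Finset.mem_filter, Finset.mem_range] at hk
    obtain ⟨hkn, hk⟩ := hk
    classical
    -- The left end of the run ending at `k` is the least `i` such that all steps after `i` up to
    -- `k` have the direction of step `k`.
    have hex : ∃ i : ℕ, ∀ l : ℕ, i < l → l ≤ k → (IsAscent π l ↔ IsAscent π k) :=
      ⟨k, fun l h1 h2 => by omega⟩
    have hspec := Nat.find_spec hex
    have hmin := fun m => Nat.find_min hex (m := m)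
    have hle : Nat.find hex ≤ k := Nat.find_min' hex (fun l h1 h2 => by omega)
    -- The single step into `k` has constant direction, so the run has length at least two when `k >
    -- 0`; for `k = 0` the truncated subtraction gives `i = 0`.
    have hle' : Nat.find hex ≤ k - 1 := Nat.find_min' hex (fun l h1 h2 => by
      rw [show l = k by omega])
    generalize Nat.find hex = i at hspec hmin hle hle'
    refine ⟨(⟨i, by omega⟩, ⟨k, hkn⟩), ?_, rfl⟩
    simp only [Finset.mem_filter, Finset.mem_univ, true_and, isUpDownRun_iff]
    refine ⟨⟨hspec, hk⟩, ?_⟩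
    rcases Nat.eq_zero_or_pos k with h0 | h0
    · right; omega
    · left
      refine ⟨by omega, ?_⟩
      by_contra! hc
      refine hmin (i - 1) (by omega) fun l h1 h2 => ?_
      rcases (show l = i ∨ i < l by omega) with rfl | h3
      · exact hc.2
      · exact hspec l h3 h2

end Runs

/-! ### Building permutations by appending a last letter -/

section Append

variable {n : ℕ}

/-- Append the letter `x` to the word of `σ`, raising the letters that are at least `x`. -/
noncomputable def appendLetter (x : Fin (n + 1)) (σ : Equiv.Perm (Fin n)) :
    Equiv.Perm (Fin (n + 1)) :=
  Equiv.ofBijective (Fin.snoc (α := fun _ => Fin (n + 1)) (fun i => x.succAbove (σ i)) x) <| by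
    rw [← Finite.injective_iff_bijective]
    intro a b
    induction a using Fin.lastCases with
    | last =>
      induction b using Fin.lastCases with
      | last => simp
      | cast b => simp
    | cast a =>
      induction b using Fin.lastCases with
      | last => simp
      | cast b => simp

@[simp] theorem appendLetter_last (x : Fin (n + 1)) (σ : Equiv.Perm (Fin n)) :
    appendLetter x σ (Fin.last n) = x := by
  simp [appendLetter]

@[simp] theorem appendLetter_castSucc (x : Fin (n + 1)) (σ : Equiv.Perm (Fin n)) (i : Fin n) :
    appendLetter x σ i.castSucc = x.succAbove (σ i) := by
  simp [appendLetter]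

theorem appendLetter_bijective :
    Function.Bijective fun p : Fin (n + 1) × Equiv.Perm (Fin n) => appendLetter p.1 p.2 := by
  rw [Fintype.bijective_iff_injective_and_card]
  constructor
  · rintro ⟨x, σ⟩ ⟨y, τ⟩ h
    have hx : x = y := by
      have := congrArg (fun π => π (Fin.last n)) h
      simpa using this
    subst hx
    congr 1
    ext i
    have := congrArg (fun π => π i.castSucc) h
    simpa [Fin.val_inj] using this
  · simp [Fintype.card_perm, Nat.factorial_succ]

theorem sum_perm_succ {M : Type*} [AddCommMonoid M] (f : Equiv.Perm (Fin (n + 1)) → M) :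
    ∑ π, f π = ∑ σ : Equiv.Perm (Fin n), ∑ x : Fin (n + 1), f (appendLetter x σ) := by
  rw [← appendLetter_bijective.sum_comp, Fintype.sum_prod_type, Finset.sum_comm]

theorem letter_appendLetter_last (x : Fin (n + 1)) (σ : Equiv.Perm (Fin n)) :
    letter (appendLetter x σ) n = x := by
  have := letter_val (appendLetter x σ) (Fin.last n)
  simpa using this

theorem letter_appendLetter_of_lt (x : Fin (n + 1)) (σ : Equiv.Perm (Fin n)) {k : ℕ}
    (hk : k < n) :
    letter (appendLetter x σ) k = if letter σ k < x then letter σ k else letter σ k + 1 := by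
  have h1 := letter_val (appendLetter x σ) (Fin.castSucc ⟨k, hk⟩)
  have h2 := letter_val σ ⟨k, hk⟩
  simp only [Fin.val_castSucc, appendLetter_castSucc] at h1 h2
  rw [h1, h2]
  unfold Fin.succAbove
  simp only [Fin.lt_def, Fin.val_castSucc]
  split_ifs <;> simp

theorem isAscent_appendLetter_of_lt (x : Fin (n + 1)) (σ : Equiv.Perm (Fin n)) {k : ℕ}
    (hk : k < n) : IsAscent (appendLetter x σ) k ↔ IsAscent σ k := by
  unfold IsAscent
  rw [letter_appendLetter_of_lt x σ hk, letter_appendLetter_of_lt x σ (show k - 1 < n by omega)]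
  refine or_congr_right ?_
  split_ifs <;> omega

theorem isAscent_appendLetter_last (x : Fin (n + 2)) (σ : Equiv.Perm (Fin (n + 1))) :
    IsAscent (appendLetter x σ) (n + 1) ↔ letter σ n < x := by
  unfold IsAscent
  rw [letter_appendLetter_last, Nat.add_sub_cancel, letter_appendLetter_of_lt x σ n.lt_succ_self]
  by_cases h : letter σ n < x
  · simp [h]
  · simp [h]
    omega

/-- The old last position, always a right end before, remains one exactly when the new step changes
direction; the new last position is always a right end. -/
theorem udr_appendLetter (x : Fin (n + 2)) (σ : Equiv.Perm (Fin (n + 1))) :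
    udr (appendLetter x σ)
      = udr σ + if (IsAscent σ n ↔ letter σ n < x) then 0 else 1 := by
  rw [udr_eq_card_ends, udr_eq_card_ends, Finset.card_filter, Finset.card_filter,
    Finset.sum_range_succ, Finset.sum_range_succ, Finset.sum_range_succ]
  have h : ∀ k ∈ Finset.range n,
      (if k + 1 = n + 1 + 1 ∨ ¬ (IsAscent (appendLetter x σ) k ↔
          IsAscent (appendLetter x σ) (k + 1)) then 1 else 0)
        = (if k + 1 = n + 1 ∨ ¬ (IsAscent σ k ↔ IsAscent σ (k + 1)) then 1 else 0 : ℕ) := by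
    intro k hk
    have hk' := Finset.mem_range.1 hk
    simp only [isAscent_appendLetter_of_lt x σ (show k < n + 1 by omega),
      isAscent_appendLetter_of_lt x σ (show k + 1 < n + 1 by omega),
      show k + 1 ≠ n + 1 + 1 by omega, show k + 1 ≠ n + 1 by omega]
  rw [Finset.sum_congr rfl h]
  simp only [isAscent_appendLetter_of_lt x σ n.lt_succ_self, isAscent_appendLetter_last]
  by_cases hc : IsAscent σ n ↔ letter σ n < x <;> simp [hc]

theorem inv_appendLetter (x : Fin (n + 1)) (σ : Equiv.Perm (Fin n)) :
    inv (appendLetter x σ) = inv σ + (n - x) := by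
  unfold inv
  rw [Finset.card_filter, Finset.card_filter, Fintype.sum_prod_type, Fintype.sum_prod_type,
    Fin.sum_univ_castSucc]
  simp only [Fin.sum_univ_castSucc, appendLetter_last, appendLetter_castSucc,
    Fin.succAbove_lt_succAbove_iff, Fin.castSucc_lt_castSucc_iff, Fin.castSucc_lt_last, true_and,
    lt_irrefl, false_and, if_false, Finset.sum_add_distrib, not_lt.2 (Fin.castSucc_lt_last _).le,
    Finset.sum_const_zero, add_zero]
  congr 1
  -- The new inversions depend only on the set of earlier letters, so `σ` can be summed away.
  rw [Equiv.sum_comp σ (fun v => if x < x.succAbove v then 1 else 0)]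
  simp only [Fin.lt_succAbove_iff_le_castSucc, Fin.le_def, Fin.val_castSucc]
  rw [Fin.sum_univ_eq_sum_range (fun v => if (x : ℕ) ≤ v then 1 else 0), ← Finset.card_filter]
  have : (Finset.range n).filter (fun v => (x : ℕ) ≤ v) = Finset.Ico (x : ℕ) n := by
    ext v; simp; omega
  rw [this, Nat.card_Ico]

theorem udr_fin_one (π : Equiv.Perm (Fin 1)) : udr π = 1 := by
  rw [udr_eq_card_ends, Finset.card_filter, Finset.sum_range_one, if_pos (Or.inl rfl)]

theorem inv_fin_one (π : Equiv.Perm (Fin 1)) : inv π = 0 := by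
  unfold inv
  rw [Finset.card_eq_zero, Finset.filter_eq_empty_iff]
  rintro ⟨a, b⟩ -
  simp [Subsingleton.elim a b]

end Append

/-! ### The letter-by-letter recursion for the weights -/

section Transfer

variable {K : Type*} [Field K]

/-- The permutations of size `n + 1` with last letter `j` and last step up (`true`) or down
(`false`), weighted by `c ^ (n + 1) * q ^ inv * T ^ udr`, computed letter by letter. -/
def runWeight (q c T : K) : ℕ → Bool → ℕ → K
  | 0, true, _ => c * T
  | 0, false, _ => 0
  | n + 1, true, j =>
    c * q ^ (n + 1 - j) *
      ∑ i ∈ Finset.range j, (runWeight q c T n true i + T * runWeight q c T n false i)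
  | n + 1, false, j =>
    c * q ^ (n + 1 - j) *
      ∑ i ∈ Finset.Ico j (n + 1), (T * runWeight q c T n true i + runWeight q c T n false i)

/-- The test function `φ` is arbitrary so that the induction closes: summing out the appended letter
turns `φ` into another test function of the previous last letter and step. -/
theorem sum_perm_eq_sum_runWeight (q c T : K) (n : ℕ) (φ : ℕ → Bool → K) :
    ∑ π : Equiv.Perm (Fin (n + 1)),
        c ^ (n + 1) * (q ^ inv π * T ^ udr π) * φ (letter π n) (decide (IsAscent π n))
      = ∑ j ∈ Finset.range (n + 1),
          (runWeight q c T n true j * φ j true + runWeight q c T n false j * φ j false) := by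
  induction n generalizing φ with
  | zero =>
    have h : ∀ π : Equiv.Perm (Fin 1), letter π 0 = 0 := fun π => by
      have := (π ⟨0, by omega⟩).2
      simp [letter]
    simp [runWeight, udr_fin_one, inv_fin_one, h, isAscent_zero]
  | succ n ih =>
    set ψ : ℕ → Bool → K := fun i s => ∑ x ∈ Finset.range (n + 2),
      c * q ^ (n + 1 - x) * (if s = decide (i < x) then 1 else T) * φ x (decide (i < x)) with hψ
    have hl : ∑ π : Equiv.Perm (Fin (n + 1 + 1)), c ^ (n + 1 + 1) * (q ^ inv π * T ^ udr π) *
          φ (letter π (n + 1)) (decide (IsAscent π (n + 1)))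
        = ∑ π : Equiv.Perm (Fin (n + 1)),
          c ^ (n + 1) * (q ^ inv π * T ^ udr π) * ψ (letter π n) (decide (IsAscent π n)) := by
      rw [sum_perm_succ]
      refine Finset.sum_congr rfl fun σ _ => ?_
      rw [hψ]
      simp only [Finset.mul_sum]
      rw [← Fin.sum_univ_eq_sum_range (fun x => c ^ (n + 1) * (q ^ inv σ * T ^ udr σ) *
        (c * q ^ (n + 1 - x) * (if decide (IsAscent σ n) = decide (letter σ n < x) then 1 else T) *
          φ x (decide (letter σ n < x))))]
      refine Finset.sum_congr rfl fun x _ => ?_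
      rw [inv_appendLetter, udr_appendLetter, letter_appendLetter_last]
      simp only [isAscent_appendLetter_last, decide_eq_decide]
      split_ifs <;> ring
    rw [hl, ih ψ]
    simp only [hψ, Finset.mul_sum, ← Finset.sum_add_distrib]
    rw [Finset.sum_comm]
    refine Finset.sum_congr rfl fun x hx => ?_
    have hx' := Finset.mem_range.1 hx
    simp only [runWeight]
    -- Previous last letters `i < x` yield an ascent, those with `i ≥ x` a descent.
    rw [Finset.range_eq_Ico, ← Finset.sum_Ico_consecutive _ (Nat.zero_le x)
      (show x ≤ n + 1 by omega), ← Finset.range_eq_Ico]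
    simp only [Finset.mul_sum, Finset.sum_mul]
    congr 1
    · refine Finset.sum_congr rfl fun i hi => ?_
      simp [Finset.mem_range.1 hi]
      ring
    · refine Finset.sum_congr rfl fun i hi => ?_
      simp [not_lt.2 (Finset.mem_Ico.1 hi).1]
      ring

theorem pow_mul_invUdrPoly (q c T : K) (n : ℕ) :
    c ^ (n + 1) * invUdrPoly (n + 1) q T
      = ∑ j ∈ Finset.range (n + 1), (runWeight q c T n true j + runWeight q c T n false j) := by
  simpa [invUdrPoly, Finset.mul_sum] using sum_perm_eq_sum_runWeight q c T n fun _ _ => 1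

end Transfer
-- Block decomposition and the generating functions
section GeneratingFunctions

variable {K : Type*} [Field K] {q : K}

theorem mk_div_qFactorial_eq_mul (hq : ∀ n : ℕ, 1 ≤ n → qNumber q n ≠ 0) (a b g : ℕ → K)
    (h : ∀ n, a n = ∑ m ∈ Finset.range (n + 1), b (n - m) * (g m * qChoose q n m)) :
    PowerSeries.mk (fun n => a n / qFactorial q n)
      = PowerSeries.mk (fun n => g n / qFactorial q n)
        * PowerSeries.mk (fun n => b n / qFactorial q n) := by
  ext n
  rw [PowerSeries.coeff_mul, Finset.Nat.sum_antidiagonal_eq_sum_range_succ_mk]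
  simp only [PowerSeries.coeff_mk]
  rw [h n, Finset.sum_div]
  refine Finset.sum_congr rfl fun m hm => ?_
  have hm' : m ≤ n := Nat.lt_succ_iff.1 (Finset.mem_range.1 hm)
  rw [qChoose, if_pos hm']
  have := qFactorial_ne_zero hq n
  have := qFactorial_ne_zero hq m
  have := qFactorial_ne_zero hq (n - m)
  field_simp

/-- Total weight of the maps of a word of length `n` to alternating up and down blocks, the last
block being an up block. -/
def oddBlocks (q c T t : K) : ℕ → K
  | 0 => t
  | n + 1 => (1 + t ^ 2) / 2 *
      ∑ j ∈ Finset.range (n + 1), (runWeight q c T n true j + T * runWeight q c T n false j)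

/-- Total weight of the maps of a word of length `n` to alternating up and down blocks, the last
block being a down block. -/
def evenBlocks (q c T t : K) : ℕ → K
  | 0 => 1
  | n + 1 => (1 + t ^ 2) / 2 *
      ∑ j ∈ Finset.range (n + 1), (T * runWeight q c T n true j + runWeight q c T n false j)

theorem sum_range_eq_add_sum_Ico (f : ℕ → K) {j n : ℕ} (h : j ≤ n) :
    ∑ i ∈ Finset.range n, f i = ∑ i ∈ Finset.range j, f i + ∑ i ∈ Finset.Ico j n, f i :=
  (Finset.sum_range_add_sum_Ico f h).symm

variable [CharZero K]

/-- Remove the last, increasing block, of length `m`: what remains ends in a down block or has no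
block, and the removed block costs a factor `t`. -/
theorem oddBlocks_eq_sum (hq : ∀ n : ℕ, 1 ≤ n → qNumber q n ≠ 0) {c T t : K}
    (hc : c * (1 - t ^ 2) = 1 + t ^ 2) (hT : T * (1 + t ^ 2) = 2 * t) (n : ℕ) :
    oddBlocks q c T t n = ∑ m ∈ Finset.range (n + 1),
      t * evenBlocks q c T t (n - m) * (1 * qChoose q n m) := by
  cases n with
  | zero => simp [oddBlocks, evenBlocks, qChoose_self hq]
  | succ n =>
    have key := partial_sum_of_ascent_rec hq
      -- The weight of the cuttings in which the last letter `j` itself lies in an up block. It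
      -- either opens that block, whence the inhomogeneous term `t * evenBlocks`, or extends it past
      -- a smaller letter.
      (fun n j => (1 - t ^ 2) / 2 * (runWeight q c T n true j + t * runWeight q c T n false j))
      (fun n => t * evenBlocks q c T t n) ?_ ?_ n (n + 1) le_rfl
    -- The term `m = 0` is the empty last block.
    · rw [Finset.sum_range_succ']
      simp only [Nat.sub_self, mul_zero, pow_zero, one_mul] at key
      simp only [Nat.add_sub_add_right, one_mul, Nat.sub_zero, qChoose_zero hq, mul_one]
      rw [← key]
      simp only [oddBlocks, evenBlocks, Finset.mul_sum, ← Finset.sum_add_distrib]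
      refine Finset.sum_congr rfl fun j _ => ?_
      linear_combination (runWeight q c T n false j / 2 - t * runWeight q c T n true j / 2) * hT
    · simp only [runWeight, evenBlocks]
      linear_combination T / 2 * hc + 1 / 2 * hT
    · intro n j hj
      -- Full row sums are split at `j` because ascents into `j` use the letters below `j` and
      -- descents the others; an identity between the four partial sums remains.
      simp only [runWeight, evenBlocks, sum_range_eq_add_sum_Ico _ hj, Finset.sum_add_distrib,
        ← Finset.mul_sum]
      generalize ∑ i ∈ Finset.range j, runWeight q c T n true i = a
      generalize ∑ i ∈ Finset.range j, runWeight q c T n false i = b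
      generalize ∑ i ∈ Finset.Ico j (n + 1), runWeight q c T n true i = a'
      generalize ∑ i ∈ Finset.Ico j (n + 1), runWeight q c T n false i = b'
      linear_combination q ^ (n + 1 - j) / 2 * (a + T * b + t * (T * a' + b')) * hc
        + q ^ (n + 1 - j) / 2 * (b - t * a) * hT

/-- The same removal for a decreasing last block. The correction `1 - t ^ 2` at `n = 0` is the
normalized weight of the cutting into no blocks, which has no last block to remove. -/
theorem evenBlocks_eq_sum (hq : ∀ n : ℕ, 1 ≤ n → qNumber q n ≠ 0) {c T t : K}
    (hc : c * (1 - t ^ 2) = 1 + t ^ 2) (hT : T * (1 + t ^ 2) = 2 * t) (n : ℕ) :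
    evenBlocks q c T t n - (if n = 0 then 1 - t ^ 2 else 0) = ∑ m ∈ Finset.range (n + 1),
      t * oddBlocks q c T t (n - m) * (q ^ (m.choose 2) * qChoose q n m) := by
  cases n with
  | zero => simp [oddBlocks, evenBlocks, qChoose_self hq]; ring
  | succ n =>
    have key := partial_sum_of_descent_rec hq
      (fun n j => (1 - t ^ 2) / 2 * (t * runWeight q c T n true j + runWeight q c T n false j))
      (fun n => t * oddBlocks q c T t n) ?_ ?_ n 0 (Nat.zero_le _)
    · rw [Finset.sum_range_succ']
      simp only [Nat.sub_zero, ← Finset.range_eq_Ico] at key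
      simp only [Nat.add_sub_add_right, Nat.choose_zero_succ, pow_zero, Nat.sub_zero,
        qChoose_zero hq, mul_one]
      rw [← key]
      simp only [oddBlocks, evenBlocks, Finset.mul_sum, ← Finset.sum_add_distrib,
        Nat.succ_ne_zero, if_false, sub_zero]
      refine Finset.sum_congr rfl fun j _ => ?_
      linear_combination (runWeight q c T n true j / 2 - t * runWeight q c T n false j / 2) * hT
    · simp only [runWeight, oddBlocks]
      linear_combination t * T / 2 * hc + t / 2 * hT
    · intro n j hj
      simp only [runWeight, oddBlocks, sum_range_eq_add_sum_Ico _ hj, Finset.sum_add_distrib,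
        ← Finset.mul_sum]
      generalize ∑ i ∈ Finset.range j, runWeight q c T n true i = a
      generalize ∑ i ∈ Finset.range j, runWeight q c T n false i = b
      generalize ∑ i ∈ Finset.Ico j (n + 1), runWeight q c T n true i = a'
      generalize ∑ i ∈ Finset.Ico j (n + 1), runWeight q c T n false i = b'
      linear_combination q ^ (n + 1 - j) / 2 * (t * (a + T * b) + T * a' + b') * hc
        + q ^ (n + 1 - j) / 2 * (a' - t * b') * hT

/-- The `inv`-`udr` generating function identity with the denominator cleared. -/
theorem one_add_qGenFun_mul (hq : ∀ n : ℕ, 1 ≤ n → qNumber q n ≠ 0) {t : K}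
    (h1 : 1 - t ^ 2 ≠ 0) (h2 : 1 + t ^ 2 ≠ 0) :
    (1 + PowerSeries.C ((1 + t) / 2) * qGenFun q (fun n =>
          ((1 + t ^ 2) / (1 - t ^ 2)) ^ n * invUdrPoly n q (2 * t / (1 + t ^ 2)))) *
        (1 - PowerSeries.C (t ^ 2) * smallExp q * bigExp q)
      = PowerSeries.C (1 - t) * (1 + PowerSeries.C t * smallExp q) := by
  obtain ⟨c, hc'⟩ : ∃ c, c = (1 + t ^ 2) / (1 - t ^ 2) := ⟨_, rfl⟩
  obtain ⟨T, hT'⟩ : ∃ T, T = 2 * t / (1 + t ^ 2) := ⟨_, rfl⟩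
  have hc : c * (1 - t ^ 2) = 1 + t ^ 2 := by rw [hc']; field_simp
  have hT : T * (1 + t ^ 2) = 2 * t := by rw [hT']; field_simp
  rw [← hc', ← hT']
  have h3 : 1 + t ≠ 0 := fun h => h1 (by linear_combination (1 - t) * h)
  set Y := PowerSeries.mk (fun n => oddBlocks q c T t n / qFactorial q n) with hY
  set Z := PowerSeries.mk (fun n => evenBlocks q c T t n / qFactorial q n) with hZ
  have hYZ : Y = smallExp q * (PowerSeries.C t * Z) := by
    rw [hY, mk_div_qFactorial_eq_mul hq _ (fun n => t * evenBlocks q c T t n) (fun _ => 1)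
      (oddBlocks_eq_sum hq hc hT), smallExp]
    congr 1
    ext n
    simp [hZ, mul_div_assoc]
  have hZY : Z - PowerSeries.C (1 - t ^ 2) = bigExp q * (PowerSeries.C t * Y) := by
    have := mk_div_qFactorial_eq_mul hq
      (fun n => evenBlocks q c T t n - if n = 0 then 1 - t ^ 2 else 0)
      (fun n => t * oddBlocks q c T t n) (fun m => q ^ (m.choose 2)) (evenBlocks_eq_sum hq hc hT)
    rw [← bigExp] at this
    convert this using 1
    · ext n
      simp only [hZ, map_sub (PowerSeries.coeff n), PowerSeries.coeff_C, PowerSeries.coeff_mk]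
      rcases n with _ | n <;> simp [qFactorial_zero]
    · congr 1
      ext n
      simp [hY, mul_div_assoc]
  -- For `n ≥ 1` the sum of the two block weights carries `(1+t²)/2 * (1+T) = (1+t)²/2`, and
  -- division by `1 + t` leaves `(1+t)/2`. The constant term is `(t + 1)/(1 + t) = 1`.
  have hG : 1 + PowerSeries.C ((1 + t) / 2) * qGenFun q (fun n => c ^ n * invUdrPoly n q T)
      = PowerSeries.C (1 + t)⁻¹ * (Y + Z) := by
    ext n
    rcases n with _ | n
    · simp [qGenFun, hY, hZ, oddBlocks, evenBlocks, qFactorial_zero]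
      field_simp
      ring
    · simp only [qGenFun, hY, hZ, map_add, PowerSeries.coeff_C_mul, PowerSeries.coeff_mk,
        PowerSeries.coeff_one, Nat.succ_ne_zero, if_false, zero_add, oddBlocks, evenBlocks]
      rw [pow_mul_invUdrPoly]
      simp only [Finset.sum_add_distrib, ← Finset.mul_sum]
      have := qFactorial_ne_zero hq (n + 1)
      generalize ∑ i ∈ Finset.range (n + 1), runWeight q c T n true i = a
      generalize ∑ i ∈ Finset.range (n + 1), runWeight q c T n false i = b
      field_simp
      linear_combination -(a + b) * hT
  have hC : PowerSeries.C (1 + t)⁻¹ * PowerSeries.C (1 - t ^ 2) = PowerSeries.C (1 - t) := by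
    rw [← map_mul]
    congr 1
    field_simp
    ring
  rw [hG, ← hC, map_pow]
  linear_combination PowerSeries.C (1 + t)⁻¹ *
    ((1 + PowerSeries.C t * smallExp q) * hZY + (1 + PowerSeries.C t * bigExp q) * hYZ)

end GeneratingFunctions
-- Inverting the substitution
section Inversion

variable {K : Type*} [Field K] {q : K}

theorem rescale_C (a b : K) : PowerSeries.rescale a (PowerSeries.C b) = PowerSeries.C b := by
  ext n
  rcases n with _ | n <;> simp [PowerSeries.coeff_rescale, PowerSeries.coeff_C]

theorem rescale_qGenFun {c d : K} (h : c * d = 1) (a : ℕ → K) :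
    PowerSeries.rescale c (qGenFun q fun n => d ^ n * a n) = qGenFun q a := by
  ext n
  simp only [qGenFun, PowerSeries.coeff_rescale, PowerSeries.coeff_mk]
  split_ifs
  · simp
  · rw [← mul_div_assoc, ← mul_assoc, ← mul_pow, h, one_pow, one_mul]

theorem constantCoeff_smallExp : PowerSeries.constantCoeff (smallExp q) = 1 := by
  rw [← PowerSeries.coeff_zero_eq_constantCoeff_apply, smallExp, PowerSeries.coeff_mk,
    qFactorial_zero, div_one]

theorem constantCoeff_bigExp : PowerSeries.constantCoeff (bigExp q) = 1 := by
  rw [← PowerSeries.coeff_zero_eq_constantCoeff_apply, bigExp, PowerSeries.coeff_mk,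
    qFactorial_zero, Nat.choose_zero_succ, pow_zero, div_one]

theorem constantCoeff_rescale (c : K) (f : PowerSeries K) :
    PowerSeries.constantCoeff (PowerSeries.rescale c f) = PowerSeries.constantCoeff f := by
  rw [← PowerSeries.coeff_zero_eq_constantCoeff_apply, PowerSeries.coeff_rescale, pow_zero,
    one_mul, PowerSeries.coeff_zero_eq_constantCoeff_apply]

variable [CharZero K]

/-- Replacing `x` by `(1-v²)/(1+v²) x` cancels the `n`-th powers in the cleared form of (a). -/
theorem qGenFun_eq_invertedForm (hq : ∀ n : ℕ, 1 ≤ n → qNumber q n ≠ 0) {v : K}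
    (h1 : 1 - v ^ 2 ≠ 0) (h2 : 1 + v ^ 2 ≠ 0) :
    qGenFun q (fun n => invUdrPoly n q (2 * v / (1 + v ^ 2))) = invertedForm q v := by
  have h3 : 1 + v ≠ 0 := fun h => h1 (by linear_combination (1 - v) * h)
  have key := congrArg (PowerSeries.rescale ((1 - v ^ 2) / (1 + v ^ 2)))
    (one_add_qGenFun_mul hq h1 h2)
  simp only [map_mul, map_add, map_sub, map_one, rescale_C] at key
  rw [rescale_qGenFun (by field_simp)] at key
  have hC : PowerSeries.C (2 / (1 + v)) * PowerSeries.C ((1 + v) / 2)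
      = (1 : PowerSeries K) := by
    rw [← map_mul, show 2 / (1 + v) * ((1 + v) / 2) = 1 by field_simp, map_one]
  simp only [← map_one (PowerSeries.C (R := K)), ← map_sub] at key
  rw [map_one] at key
  rw [invertedForm, ← (PowerSeries.eq_mul_inv_iff_mul_eq _).2 key]
  · linear_combination -qGenFun q (fun n => invUdrPoly n q (2 * v / (1 + v ^ 2))) * hC
  · simpa [constantCoeff_rescale, constantCoeff_smallExp, constantCoeff_bigExp] using h1

/-- For either square root `s`, `v = (1-s)/t` solves `t v² - 2v + t = 0`, that is, `2v/(1+v²) = t`.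
The factorizations of `1 ± v²` show that both are nonzero, since `s ≠ 0` and `s ≠ 1`. -/
theorem qGenFun_eq_invertedForm_of_sq (hq : ∀ n : ℕ, 1 ≤ n → qNumber q n ≠ 0) {t s : K}
    (ht : t ≠ 0) (ht1 : 1 - t ^ 2 ≠ 0) (hs : s ^ 2 = 1 - t ^ 2) :
    qGenFun q (fun n => invUdrPoly n q t) = invertedForm q ((1 - s) / t) := by
  have hs0 : s ≠ 0 := fun h => ht1 (by rw [← hs, h]; ring)
  have hs1 : 1 - s ≠ 0 := fun h => ht (pow_eq_zero_iff (two_ne_zero) |>.1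
    (show t ^ 2 = 0 by linear_combination (1 + s) * h + hs))
  have e1 : 1 - ((1 - s) / t) ^ 2 = 2 * s * (1 - s) / t ^ 2 := by
    field_simp
    linear_combination hs
  have e2 : 1 + ((1 - s) / t) ^ 2 = 2 * (1 - s) / t ^ 2 := by
    field_simp
    linear_combination hs
  have e3 : 2 * ((1 - s) / t) / (1 + ((1 - s) / t) ^ 2) = t := by
    rw [e2]
    field_simp
  have := qGenFun_eq_invertedForm hq (v := (1 - s) / t)
    (by rw [e1]; simp [ht, hs0, hs1]) (by rw [e2]; simp [ht, hs1])
  rwa [e3] at this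

end Inversion

/-! ### The case of an indeterminate over Laurent series -/

section Formal

variable (K : Type*) [Field K]

theorem qNumber_map {R S : Type*} [CommSemiring R] [CommSemiring S] (f : R →+* S) (q : R) (n : ℕ) :
    qNumber (f q) n = f (qNumber q n) := by
  simp [qNumber]

theorem formalT_ne_zero : formalT K ≠ 0 := by
  rw [formalT, Ne, map_eq_zero_iff _ HahnSeries.ofPowerSeries_injective]
  exact PowerSeries.X_ne_zero

theorem one_sub_formalT_sq_ne_zero : 1 - formalT K ^ 2 ≠ 0 := by
  have h : 1 - formalT K ^ 2
      = ((1 - PowerSeries.X ^ 2 : PowerSeries K) : LaurentSeries K) := by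
    simp only [formalT, map_sub, map_one, map_pow]
  rw [h, Ne, map_eq_zero_iff _ HahnSeries.ofPowerSeries_injective]
  intro h0
  simpa using congrArg PowerSeries.constantCoeff h0

variable [CharZero K]

theorem charZero_laurentSeries : CharZero (LaurentSeries K) :=
  charZero_of_injective_ringHom (HahnSeries.C_injective (Γ := ℤ) (R := K))

/-- The binomial series of exponent `1/2` squares to `1 + X` by additivity in the exponent, and
substituting `-X²` is a ring homomorphism. -/
theorem sqrtSeries_sq : sqrtSeries K ^ 2 = 1 - PowerSeries.X ^ 2 := by
  have ha : PowerSeries.HasSubst (-(PowerSeries.X ^ 2) : PowerSeries K) :=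
    PowerSeries.HasSubst.of_constantCoeff_zero' (by simp)
  have h : PowerSeries.binomialSeries K (1 / 2 : ℚ) * PowerSeries.binomialSeries K (1 / 2 : ℚ)
      = 1 + PowerSeries.X := by
    rw [← PowerSeries.binomialSeries_add, show (1 / 2 : ℚ) + 1 / 2 = ((1 : ℕ) : ℚ) by norm_num,
      PowerSeries.binomialSeries_nat, pow_one]
  rw [sqrtSeries, sq, ← PowerSeries.subst_mul ha, h, ← PowerSeries.coe_substAlgHom ha, map_add,
    map_one, PowerSeries.substAlgHom_X ha, sub_eq_add_neg]

end Formal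
end UpDownRuns

/-- The parameters `q`, `t` range over all values in a field of characteristic zero at which the
formulas have no zero denominator (so they may be indeterminates); all identities are between
formal power series in `x`. The square root of `1 - t²` is any `s` in the field with
`s² = 1 - t²`, and in the last part the formal power series in an indeterminate `t`. -/
theorem theorem4p13 {K : Type*} [Field K] [CharZero K] (q : K)
    (hq : ∀ n : ℕ, 1 ≤ n → UpDownRuns.qNumber q n ≠ 0) :
    (∀ t : K, 1 - t ^ 2 ≠ 0 → 1 + t ^ 2 ≠ 0 →
      PowerSeries.C (1 - t) * (1 + PowerSeries.C t * UpDownRuns.smallExp q) *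
          (1 - PowerSeries.C (t ^ 2) * UpDownRuns.smallExp q * UpDownRuns.bigExp q)⁻¹
        = 1 + PowerSeries.C ((1 + t) / 2) *
            UpDownRuns.qGenFun q (fun n =>
              ((1 + t ^ 2) / (1 - t ^ 2)) ^ n *
                UpDownRuns.invUdrPoly n q (2 * t / (1 + t ^ 2)))) ∧
    (∀ t s : K, t ≠ 0 → 1 - t ^ 2 ≠ 0 → s ^ 2 = 1 - t ^ 2 →
      UpDownRuns.qGenFun q (fun n => UpDownRuns.invUdrPoly n q t)
        = UpDownRuns.invertedForm q ((1 - s) / t)) ∧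
    UpDownRuns.qGenFun (HahnSeries.C q : LaurentSeries K)
        (fun n => UpDownRuns.invUdrPoly n (HahnSeries.C q : LaurentSeries K)
          (UpDownRuns.formalT K))
      = UpDownRuns.invertedForm (HahnSeries.C q : LaurentSeries K) (UpDownRuns.formalV K) := by
  refine ⟨fun t h1 h2 => ?_, fun t s ht ht1 hs =>
    UpDownRuns.qGenFun_eq_invertedForm_of_sq hq ht ht1 hs, ?_⟩
  · symm
    rw [PowerSeries.eq_mul_inv_iff_mul_eq]
    · exact UpDownRuns.one_add_qGenFun_mul hq h1 h2
    · simpa [UpDownRuns.constantCoeff_smallExp, UpDownRuns.constantCoeff_bigExp] using h1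
  -- The formal statement is the preceding one over the field `K((t))`, with `s` the binomial square
  -- root; nonvanishing of the q-numbers passes along the embedding of constants.
  · have := UpDownRuns.charZero_laurentSeries K
    refine UpDownRuns.qGenFun_eq_invertedForm_of_sq (fun n hn => ?_)
      (UpDownRuns.formalT_ne_zero K) (UpDownRuns.one_sub_formalT_sq_ne_zero K) ?_
    · rw [UpDownRuns.qNumber_map, Ne, map_eq_zero_iff _ HahnSeries.C_injective]
      exact hq n hn
    · rw [← map_pow, UpDownRuns.sqrtSeries_sq, map_sub, map_one, map_pow, UpDownRuns.formalT]
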